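/- A hypergraph is a pair $H=(V,E)$ with $V$ a finite set of vertices and $E$ a set of subsets of $V$ (the edges). Write $v(H)=|V|$ and $e_r(H)=|\{e\in E:|e|=r\}|$. The 2-section $[H]_2$ is the graph on $V$ in which two distinct vertices are adjacent iff some edge of $H$ contains both. A strong subgraph of $H$ is a hypergraph $H'=(V',E')$ with $V'\subseteq V$ and $E'\subseteq E$. A subedge system of $H$ is any strong subgraph of a hypergraph obtained from $H$ by keeping the vertex set and replacing each edge by one of its subsets. Let $M\in\mathbb N$ and, for each $n$, let $\mathbf p=(p_r)_{r\ge1}$ with $p_r=p_r(n)\in[0,1]$ and $p_r=0$ for all $r>M$. The random hypergraph $\mathscr H(n,\mathbf p)$ has vertex set $\{1,\dots,n\}$, and each nonempty set $e$ of vertices is an edge, independently, with probability $p_{|e|}$. For $r\ge1$ put $$p'_r=\sum_{j=r}^{M} n^{\,j-r}p_j,$$ so that $p'_r=0$ for $r>M$, and for a hypergraph $H$ put $$\mu_w(H)=n^{v(H)}\prod_{r\ge1}(p'_r)^{e_r(H)},\qquad 0^0=1.$$ Let $G$ be a fixed finite graph without isolated vertices, and let $\mathcal F$ be the family of hypergraphs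 $H$ such that $[H]_2$ contains a copy of $G$ as a (not necessarily induced) subgraph and no subedge system of $H$ other than $H$ itself has this property. (a) If every $H\in\mathcal F$ has a strong subgraph $H'$ with nonempty vertex set and $\mu_w(H')\to0$ as $n\to\infty$, then the probability that $[\mathscr H(n,\mathbf p)]_2$ contains no copy of $G$ as a subgraph tends to $1$ as $n\to\infty$. (b) If some $H\in\mathcal F$ is such that $\mu_w(H')\to\infty$ as $n\to\infty$ for every strong subgraph $H'$ of $H$ with nonempty vertex set, then the probability that $[\mathscr H(n,\mathbf p)]_2$ contains a copy of $G$ as a subgraph tends to $1$ as $n\to\infty$. -/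

import Mathlib

open Filter Topology MeasureTheory ProbabilityTheory

namespace Hypergraph

variable {α : Type*}

/-- The 2-section of a hypergraph: the graph on its vertex set in which two distinct vertices are
adjacent when some edge contains both. -/
def twoSection (H : Hypergraph α) : SimpleGraph H.vertexSet where
  Adj u v := u ≠ v ∧ ∃ e ∈ H.edgeSet, (u : α) ∈ e ∧ (v : α) ∈ e
  symm := ⟨fun _ _ h => ⟨h.1.symm, h.2.imp fun _ he => ⟨he.1, he.2.2, he.2.1⟩⟩⟩
  loopless := ⟨fun _ h => h.1 rfl⟩

/-- Strong subhypergraph: fewer vertices and fewer edges, the edges being kept whole. -/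
def IsStrongSub (H' H : Hypergraph α) : Prop :=
  H'.vertexSet ⊆ H.vertexSet ∧ H'.edgeSet ⊆ H.edgeSet

/-- `K` is a subedge system of `H`: shrink every edge `e` of `H` to a subset `φ e` of it, keeping
the vertex set, and take a strong subhypergraph of the result. -/
def IsSubedgeSystem (K H : Hypergraph α) : Prop :=
  ∃ (φ : Set α → Set α) (H' : Hypergraph α),
    (∀ e ∈ H.edgeSet, φ e ⊆ e) ∧ H'.vertexSet = H.vertexSet ∧ H'.edgeSet = φ '' H.edgeSet ∧
      K.IsStrongSub H'

/-- The family of finite hypergraphs that contain (a copy of) `G` in their 2-section and are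
minimal with this property for the subedge system relation. Every finite hypergraph has a copy
with vertices in `ℕ`. -/
def minimalFamily {V : Type*} (G : SimpleGraph V) : Set (Hypergraph ℕ) :=
  {H | H.vertexSet.Finite ∧ G.IsContained H.twoSection ∧
    ∀ K : Hypergraph ℕ, K.IsSubedgeSystem H → G.IsContained K.twoSection → K = H}

/-- The number of edges of size `r`. -/
noncomputable def numEdges (H : Hypergraph α) (r : ℕ) : ℕ :=
  {e ∈ H.edgeSet | e.ncard = r}.ncard

/-- `p'_r = p_r + n p_{r+1} + ⋯ + n^{M-r} p_M`; this is the empty sum `0` for `r > M`. -/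
noncomputable def pPrime (M : ℕ) (p : ℕ → unitInterval) (n r : ℕ) : ℝ :=
  ∑ j ∈ Finset.Icc r M, (n : ℝ) ^ (j - r) * (p j : ℝ)

/-- `μ_w(H) = n^{v(H)} ∏_{r ≥ 1} (p'_r)^{e_r(H)}` for a finite hypergraph `H`. Edges have size at
most `v(H)`, so all other factors are `1`. -/
noncomputable def muW (M : ℕ) (p : ℕ → unitInterval) (n : ℕ) (H : Hypergraph α) : ℝ :=
  (n : ℝ) ^ H.vertexSet.ncard *
    ∏ r ∈ Finset.Icc 1 H.vertexSet.ncard, pPrime M p n r ^ H.numEdges r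

/-- Outcomes of the random hypergraph: which nonempty sets of vertices are edges. -/
abbrev Outcome (n : ℕ) : Type := {e : Finset (Fin n) // e.Nonempty} → Bool

/-- The hypergraph on `Fin n` with the edges selected by `ω`. -/
def ofOutcome {n : ℕ} (ω : Outcome n) : Hypergraph (Fin n) where
  vertexSet := Set.univ
  edgeSet := {s | ∃ e, ω e = true ∧ s = (e.1 : Set (Fin n))}
  subset_vertexSet_of_mem_edgeSet' := fun _ _ => Set.subset_univ _

/-- The law of the random hypergraph `ℋ(n, p)`: every nonempty vertex set `e` is an edge with
probability `p_{|e|}`, independently of the others. -/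
noncomputable def randomLaw (n : ℕ) (p : ℕ → unitInterval) : Measure (Outcome n) :=
  Measure.pi fun e => bernoulliMeasure true false (p e.1.card)

end Hypergraph

namespace Hypergraph

open Finset Function

/-! For fixed `M`, `pPrime` at r ≥ 1 is, up to constants, the expected number of random edges
containing a given r-set. Hence `muW` governs the expected number of placements of a hypergraph
whose edges lie inside distinct random edges (`IsCovered`).

Absence of G is a first moment argument. The traces of the random edges on a copy of G form a
covered hypergraph on |V(G)| vertices. Being covered passes to subedge systems, so a covered
hypergraph of least weight is a member of the minimal family (`exists_mem_minimalFamily_isCovered`).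
Only finitely many members have this vertex set, and the chosen strong subgraph of each is covered
with probability at most its `muW` (`randomLaw_real_isCovered_le`), so a union bound suffices.

Presence of G is a second moment argument. It is enough to place H with its edges inside random
edges, distinct or not. Since `pPrime` at r is at most M + 1 times its largest summand n^(j-r) p_j,
each edge is padded by j - r private vertices, and copies are sought whose padded edges are exactly
random edges. Two copies sharing the edges in S contribute about 1/μ_w of the subgraph spanned by S:
the private vertices supply the powers of n that turn p_j into n^(j-r) p_j. Chebyshev's inequality
bounds the failure probability by a constant times the sum of these terms over nonempty S
(`randomLaw_real_no_cover_le`), and each term tends to 0. -/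

/-- The event that all the sets in `A` are edges. -/
def allEdges {n : ℕ} (A : Finset {e : Finset (Fin n) // e.Nonempty}) : Set (Outcome n) :=
  {ω | ∀ e ∈ A, ω e = true}

instance (n : ℕ) (p : ℕ → unitInterval) : IsProbabilityMeasure (randomLaw n p) := by
  unfold randomLaw; infer_instance

theorem randomLaw_real_allEdges {n : ℕ} (p : ℕ → unitInterval)
    (A : Finset {e : Finset (Fin n) // e.Nonempty}) :
    (randomLaw n p).real (allEdges A) = ∏ e ∈ A, (p e.1.card : ℝ) := by
  classical
  have h : allEdges A = Set.univ.pi fun e => if e ∈ A then {true} else Set.univ := by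
    ext ω
    simp only [allEdges, Set.mem_ofPred_eq, Set.mem_pi, Set.mem_univ, true_imp_iff]
    refine forall_congr' fun e => ?_
    split_ifs with he <;> simp [he]
  rw [h, randomLaw, measureReal_def, Measure.pi_pi, ENNReal.toReal_prod,
    ← Finset.prod_subset (Finset.subset_univ A)]
  · refine Finset.prod_congr rfl fun e he => ?_
    rw [if_pos he, ← measureReal_def, bernoulliMeasure_real_apply_of_mem_of_notMem] <;> simp
  · intro e _ he
    simp [he]

theorem allEdges_union {n : ℕ} [DecidableEq {e : Finset (Fin n) // e.Nonempty}]
    (A B : Finset {e : Finset (Fin n) // e.Nonempty}) :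
    allEdges (A ∪ B) = allEdges A ∩ allEdges B := by
  ext ω
  simp only [allEdges, Finset.mem_union, Set.mem_ofPred_eq, Set.mem_inter_iff, or_imp,
    forall_and]

/-! ### First moment -/

/-- The expected number of edges containing a given vertex set `B` is at most `p'_{|B|}`. -/
theorem sum_superedges_le {n M : ℕ} {p : ℕ → unitInterval} (hp : ∀ r, M < r → p r = 0)
    (B : Finset (Fin n)) :
    ∑ e : {e : Finset (Fin n) // e.Nonempty} with B ⊆ e.1, (p e.1.card : ℝ)
      ≤ pPrime M p n B.card := by
  classical
  calc ∑ e : {e : Finset (Fin n) // e.Nonempty} with B ⊆ e.1, (p e.1.card : ℝ)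
      ≤ ∑ e : {e : Finset (Fin n) // e.Nonempty} with B ⊆ e.1,
          ∑ j ∈ Finset.Icc B.card M, if e.1.card = j then (p j : ℝ) else 0 := by
        refine Finset.sum_le_sum fun e he => ?_
        rw [Finset.sum_ite_eq]
        split_ifs with h
        · exact le_rfl
        · have hc := Finset.card_le_card (Finset.mem_filter.1 he).2
          rw [Finset.mem_Icc, not_and, not_le] at h
          simp [hp _ (h hc)]
    _ = ∑ j ∈ Finset.Icc B.card M,
          (#{e : {e : Finset (Fin n) // e.Nonempty} | B ⊆ e.1 ∧ e.1.card = j} : ℝ) * p j := by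
        rw [Finset.sum_comm]
        refine Finset.sum_congr rfl fun j _ => ?_
        rw [← Finset.sum_filter, Finset.filter_filter, Finset.sum_const, nsmul_eq_mul]
    _ ≤ pPrime M p n B.card := by
        refine Finset.sum_le_sum fun j _ => ?_
        refine mul_le_mul_of_nonneg_right ?_ (p j).2.1
        -- A superset of `B` is determined by its part outside `B`.
        have : #{e : {e : Finset (Fin n) // e.Nonempty} | B ⊆ e.1 ∧ e.1.card = j}
            ≤ #(Finset.powersetCard (j - B.card) (Finset.univ : Finset (Fin n))) := by
          refine Finset.card_le_card_of_injOn (fun e => e.1 \ B) ?_ ?_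
          · intro e he
            obtain ⟨h1, h2⟩ : B ⊆ e.1 ∧ e.1.card = j := by simpa using he
            simp [Finset.mem_powersetCard, Finset.card_sdiff_of_subset h1, h2]
          · intro e he e' he' h
            have h1 : B ⊆ e.1 := by simp at he; exact he.1
            have h2 : B ⊆ e'.1 := by simp at he'; exact he'.1
            apply Subtype.ext
            rw [← Finset.sdiff_union_of_subset h1, ← Finset.sdiff_union_of_subset h2]
            simp only at h
            rw [h]
        rw [Finset.card_powersetCard, Finset.card_univ, Fintype.card_fin] at this
        exact_mod_cast this.trans (Nat.choose_le_pow _ _)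

theorem pPrime_nonneg (M : ℕ) (p : ℕ → unitInterval) (n r : ℕ) : 0 ≤ pPrime M p n r :=
  Finset.sum_nonneg fun j _ => mul_nonneg (by positivity) (p j).2.1

/-- First moment bound: the probability that the sets `E f` can be placed injectively on the
vertices such that they are covered by distinct edges. -/
theorem randomLaw_real_superedges_le {W ι : Type*} [Fintype W] [Fintype ι] {n M : ℕ}
    {p : ℕ → unitInterval} (hp : ∀ r, M < r → p r = 0) (E : ι → Finset W) :
    (randomLaw n p).real {ω | ∃ ψ : W ↪ Fin n, ∃ g : ι → {e : Finset (Fin n) // e.Nonempty},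
        Injective g ∧ ∀ f, (E f).map ψ ⊆ (g f).1 ∧ ω (g f) = true}
      ≤ (n : ℝ) ^ Fintype.card W * ∏ f, pPrime M p n (E f).card := by
  classical
  let T : (W ↪ Fin n) → Finset (ι → {e : Finset (Fin n) // e.Nonempty}) := fun ψ =>
    Fintype.piFinset fun f => {e | (E f).map ψ ⊆ e.1}
  have hsub : {ω : Outcome n | ∃ ψ : W ↪ Fin n, ∃ g : ι → {e : Finset (Fin n) // e.Nonempty},
        Injective g ∧ ∀ f, (E f).map ψ ⊆ (g f).1 ∧ ω (g f) = true}
      ⊆ ⋃ ψ ∈ (Finset.univ : Finset (W ↪ Fin n)), ⋃ g ∈ {g ∈ T ψ | Injective g},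
          allEdges (Finset.univ.image g) := by
    rintro ω ⟨ψ, g, hg, h⟩
    simp only [Set.mem_iUnion]
    refine ⟨ψ, Finset.mem_univ _, g, ?_, ?_⟩
    · simp only [T, Finset.mem_filter, Fintype.mem_piFinset, Finset.mem_univ, true_and]
      exact ⟨fun f => (h f).1, hg⟩
    · intro e he
      obtain ⟨f, -, rfl⟩ := Finset.mem_image.1 he
      exact (h f).2
  calc _ ≤ _ := measureReal_mono hsub (measure_ne_top _ _)
    _ ≤ ∑ ψ : W ↪ Fin n, (randomLaw n p).real (⋃ g ∈ {g ∈ T ψ | Injective g},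
          allEdges (Finset.univ.image g)) := measureReal_biUnion_finset_le _ _
    _ ≤ ∑ ψ : W ↪ Fin n, ∏ f, pPrime M p n (E f).card := by
        refine Finset.sum_le_sum fun ψ _ => ?_
        calc _ ≤ ∑ g ∈ T ψ with Injective g,
              (randomLaw n p).real (allEdges (Finset.univ.image g)) :=
              measureReal_biUnion_finset_le _ _
          _ = ∑ g ∈ T ψ with Injective g, ∏ f, (p (g f).1.card : ℝ) := by
              refine Finset.sum_congr rfl fun g hg => ?_
              rw [randomLaw_real_allEdges, Finset.prod_image]
              exact (Finset.mem_filter.1 hg).2.injOn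
          -- Injectivity was needed only for independence; without it the sum of products factors.
          _ ≤ ∑ g ∈ T ψ, ∏ f, (p (g f).1.card : ℝ) :=
              Finset.sum_le_sum_of_subset_of_nonneg (Finset.filter_subset _ _)
                fun _ _ _ => Finset.prod_nonneg fun _ _ => (p _).2.1
          _ = ∏ f, ∑ e : {e : Finset (Fin n) // e.Nonempty} with (E f).map ψ ⊆ e.1,
                (p e.1.card : ℝ) := by rw [Finset.prod_univ_sum]
          _ ≤ _ := by
              refine Finset.prod_le_prod
                (fun _ _ => Finset.sum_nonneg fun _ _ => (p _).2.1) fun f _ => ?_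
              have := sum_superedges_le hp ((E f).map ψ)
              rwa [Finset.card_map] at this
    _ ≤ _ := by
        rw [Finset.sum_const, nsmul_eq_mul, Finset.card_univ, Fintype.card_embedding_eq,
          Fintype.card_fin]
        refine mul_le_mul_of_nonneg_right ?_
          (Finset.prod_nonneg fun _ _ => pPrime_nonneg _ _ _ _)
        exact_mod_cast Nat.descFactorial_le_pow _ _

/-! ### Second moment -/

/-- Second moment bound for a family of events of equal probability. -/
theorem randomLaw_real_no_allEdges_mul_le {I : Type*} [Fintype I] {n : ℕ} (p : ℕ → unitInterval)
    [DecidableEq {e : Finset (Fin n) // e.Nonempty}]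
    (A : I → Finset {e : Finset (Fin n) // e.Nonempty}) {P : ℝ} (hP : 0 < P)
    (hA : ∀ i, ∏ e ∈ A i, (p e.1.card : ℝ) = P) :
    (randomLaw n p).real {ω | ¬ ∃ i, ω ∈ allEdges (A i)} * (Fintype.card I : ℝ) ^ 2
      ≤ ∑ x : I × I with ¬ Disjoint (A x.1) (A x.2),
          (∏ e ∈ A x.1 ∩ A x.2, (p e.1.card : ℝ))⁻¹ := by
  classical
  set μ := randomLaw n p
  set N : ℝ := (Fintype.card I : ℝ)
  let F : I → Outcome n → ℝ := fun i => (allEdges (A i)).indicator 1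
  let X : Outcome n → ℝ := fun ω => ∑ i, F i ω
  have hint : ∀ f : Outcome n → ℝ, Integrable f μ := fun f => Integrable.of_finite
  have hF : ∀ i, ∫ ω, F i ω ∂μ = P := fun i => by
    rw [integral_indicator_one (Set.toFinite _).measurableSet, randomLaw_real_allEdges, hA]
  have hX : ∫ ω, X ω ∂μ = N * P := by
    rw [integral_finsetSum _ fun i _ => hint _]
    simp [hF, N]
  have hFF : ∀ i k, ∫ ω, F i ω * F k ω ∂μ = ∏ e ∈ A i ∪ A k, (p e.1.card : ℝ) := fun i k => by
    rw [← randomLaw_real_allEdges, allEdges_union,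
      ← integral_indicator_one (Set.toFinite _).measurableSet, Set.inter_indicator_one]
    rfl
  have hXX : ∫ ω, X ω ^ 2 ∂μ = ∑ x : I × I, ∏ e ∈ A x.1 ∪ A x.2, (p e.1.card : ℝ) := by
    have : ∀ ω, X ω ^ 2 = ∑ x : I × I, F x.1 ω * F x.2 ω := fun ω => by
      rw [sq, Finset.sum_mul_sum, ← Finset.univ_product_univ, Finset.sum_product]
    simp_rw [this]
    rw [integral_finsetSum _ fun i _ => hint _]
    exact Finset.sum_congr rfl fun x _ => hFF _ _
  have hvar : ∫ ω, (X ω - N * P) ^ 2 ∂μ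
      = ∑ x : I × I, (∏ e ∈ A x.1 ∪ A x.2, (p e.1.card : ℝ) - P ^ 2) := by
    have : ∀ ω, (X ω - N * P) ^ 2 = X ω ^ 2 - 2 * (N * P) * X ω + (N * P) ^ 2 := fun ω => by ring
    simp_rw [this]
    rw [integral_add (hint _) (hint _), integral_sub (hint _) (hint _), integral_const_mul, hX, hXX,
      Finset.sum_sub_distrib]
    simp [N]
    ring
  have hpos : ∀ i, ∀ e ∈ A i, (p e.1.card : ℝ) ≠ 0 := fun i e he h0 => by
    have := hA i
    rw [Finset.prod_eq_zero he h0] at this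
    exact hP.ne this
  have hunion : ∀ i k, ∏ e ∈ A i ∪ A k, (p e.1.card : ℝ)
      = P ^ 2 * (∏ e ∈ A i ∩ A k, (p e.1.card : ℝ))⁻¹ := fun i k => by
    rw [eq_mul_inv_iff_mul_eq₀, Finset.prod_union_inter, hA, hA, sq]
    exact Finset.prod_ne_zero_iff.2 fun e he => hpos i e (Finset.mem_inter.1 he).1
  -- Disjoint pairs are independent and have covariance zero; for the others -P² is dropped.
  have hle : ∫ ω, (X ω - N * P) ^ 2 ∂μ
      ≤ P ^ 2 * ∑ x : I × I with ¬ Disjoint (A x.1) (A x.2),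
          (∏ e ∈ A x.1 ∩ A x.2, (p e.1.card : ℝ))⁻¹ := by
    rw [hvar, Finset.mul_sum, Finset.sum_filter]
    refine Finset.sum_le_sum fun x _ => ?_
    rw [hunion]
    split_ifs with h
    · simp [Finset.disjoint_iff_inter_eq_empty.1 h]
    · linarith [sq_nonneg P]
  -- Chebyshev: where no event occurs, X = 0 and the squared deviation is (NP)².
  have hge : μ.real {ω | ¬ ∃ i, ω ∈ allEdges (A i)} * (N * P) ^ 2
      ≤ ∫ ω, (X ω - N * P) ^ 2 ∂μ := by
    rw [← smul_eq_mul, ← integral_indicator_const _ (Set.toFinite _).measurableSet]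
    refine integral_mono (hint _) (hint _) fun ω => ?_
    by_cases h : ∃ i, ω ∈ allEdges (A i)
    · simp only [Set.indicator, Set.mem_ofPred_eq, h, not_true, if_false]
      positivity
    · have hX0 : X ω = 0 := Finset.sum_eq_zero fun i _ =>
        Set.indicator_of_notMem (fun hi => h ⟨i, hi⟩) _
      simp only [Set.indicator, Set.mem_ofPred_eq, h, not_false_eq_true, if_true, hX0]
      exact le_of_eq (by ring)
  have := hge.trans hle
  rw [mul_pow, ← mul_assoc, mul_comm] at this
  exact le_of_mul_le_mul_left this (by positivity)

-- Once the second embedding is fixed, a vertex of `U` has at most |W| images under the first, which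
-- saves a factor n for each such vertex. The base |W| + 1 keeps the power monotone in the exponent
-- even for empty `W`.
open scoped Classical in
theorem card_embedding_pairs_le {W : Type*} [Fintype W] (n : ℕ) (U : Finset W) :
    #{x : (W ↪ Fin n) × (W ↪ Fin n) | ∀ u ∈ U, x.1 u ∈ Set.range x.2}
      ≤ n ^ Fintype.card W * ((Fintype.card W + 1) ^ Fintype.card W
        * n ^ (Fintype.card W - #U)) := by
  have hk : ∀ k : W ↪ Fin n, #{i : W ↪ Fin n | ∀ u ∈ U, i u ∈ Set.range k}
      ≤ (Fintype.card W + 1) ^ Fintype.card W * n ^ (Fintype.card W - #U) := fun k => by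
    calc _ ≤ #(Fintype.piFinset fun u => if u ∈ U then Finset.univ.map k else Finset.univ) := by
          refine Finset.card_le_card_of_injOn (fun i => (i : W → Fin n)) ?_
            DFunLike.coe_injective.injOn
          intro i hi
          simp only [Finset.coe_filter, Finset.mem_univ, true_and, Set.mem_ofPred_eq] at hi
          simp only [Finset.mem_coe, Fintype.mem_piFinset]
          intro u
          split_ifs with hu
          · simpa using hi u hu
          · simp
      _ = Fintype.card W ^ #U * n ^ (Fintype.card W - #U) := by
          rw [Fintype.card_piFinset]
          simp only [apply_ite Finset.card, Finset.card_map, Finset.card_univ, Fintype.card_fin]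
          rw [Finset.prod_ite, Finset.prod_const, Finset.prod_const, Finset.filter_mem_eq_inter,
            Finset.univ_inter, Finset.filter_not, Finset.filter_mem_eq_inter, Finset.univ_inter,
            Finset.card_sdiff_of_subset (Finset.subset_univ _), Finset.card_univ]
      _ ≤ _ := by
          refine Nat.mul_le_mul_right _ ?_
          exact (Nat.pow_le_pow_left (Nat.le_succ _) _).trans
            (Nat.pow_le_pow_right (Nat.succ_pos _) (Finset.card_le_univ U))
  calc #{x : (W ↪ Fin n) × (W ↪ Fin n) | ∀ u ∈ U, x.1 u ∈ Set.range x.2}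
      = ∑ k : W ↪ Fin n, #{i : W ↪ Fin n | ∀ u ∈ U, i u ∈ Set.range k} := by
        simp only [Finset.card_filter]
        exact Fintype.sum_prod_type_right _
    _ ≤ ∑ _k : W ↪ Fin n, (Fintype.card W + 1) ^ Fintype.card W * n ^ (Fintype.card W - #U) :=
        Finset.sum_le_sum fun k _ => hk k
    _ ≤ _ := by
        rw [Finset.sum_const, smul_eq_mul, Finset.card_univ, Fintype.card_embedding_eq,
          Fintype.card_fin]
        exact Nat.mul_le_mul_right _ (Nat.descFactorial_le_pow _ _)

/-- Second moment bound for placing a fixed set system with all its sets being edges. -/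
theorem randomLaw_real_no_copy_le {W ι : Type*} [Fintype W] [Fintype ι] [DecidableEq W] {n : ℕ}
    (p : ℕ → unitInterval) (E : ι → Finset W) (hE : Injective E) (hne : ∀ f, (E f).Nonempty)
    (hpos : ∀ f, 0 < (p #(E f) : ℝ)) (hn : 2 * Fintype.card W ≤ n) :
    (randomLaw n p).real
        {ω | ¬ ∃ ψ : W ↪ Fin n, ∀ f, ω ⟨(E f).map ψ, (hne f).map⟩ = true}
      ≤ 4 ^ Fintype.card W * (Fintype.card W + 1) ^ Fintype.card W *
        ∑ S : Finset ι with S.Nonempty,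
          ((n : ℝ) ^ #(S.biUnion E) * ∏ f ∈ S, (p #(E f) : ℝ))⁻¹ := by
  classical
  set w := Fintype.card W
  let edge : (W ↪ Fin n) → ι → {e : Finset (Fin n) // e.Nonempty} :=
    fun ψ f => ⟨(E f).map ψ, (hne f).map⟩
  have hedge : ∀ ψ, Injective (edge ψ) := fun ψ f g h =>
    hE (Finset.map_injective ψ (congrArg Subtype.val h))
  let A : (W ↪ Fin n) → Finset {e : Finset (Fin n) // e.Nonempty} :=
    fun ψ => Finset.univ.image (edge ψ)
  -- The pairs of copies are classified by which edges of the first also belong to the second.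
  let T : (W ↪ Fin n) × (W ↪ Fin n) → Finset ι := fun x => {f | edge x.1 f ∈ A x.2}
  have hT : ∀ x, A x.1 ∩ A x.2 = (T x).image (edge x.1) := fun x => by
    ext e
    simp only [A, T, Finset.mem_inter, Finset.mem_image, Finset.mem_filter, Finset.mem_univ,
      true_and]
    constructor
    · rintro ⟨⟨f, rfl⟩, h⟩
      exact ⟨f, h, rfl⟩
    · rintro ⟨f, h, rfl⟩
      exact ⟨⟨f, rfl⟩, h⟩
  have hmom := randomLaw_real_no_allEdges_mul_le p A (P := ∏ f, (p #(E f) : ℝ))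
    (Finset.prod_pos fun f _ => hpos f) fun ψ => by
      rw [Finset.prod_image (hedge ψ).injOn]
      simp [edge]
  have hset : {ω : Outcome n | ¬ ∃ ψ, ω ∈ allEdges (A ψ)}
      = {ω | ¬ ∃ ψ : W ↪ Fin n, ∀ f, ω ⟨(E f).map ψ, (hne f).map⟩ = true} := by
    ext ω
    simp [allEdges, A, edge]
  rw [hset] at hmom
  have hcard : (Fintype.card (W ↪ Fin n) : ℝ) = n.descFactorial w := by
    rw [Fintype.card_embedding_eq, Fintype.card_fin]
  rw [hcard] at hmom
  have hdesc : (n + 1 - w) ^ w ≤ n.descFactorial w := Nat.pow_sub_le_descFactorial n w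
  have hN0 : (0 : ℝ) < n.descFactorial w := by
    have : 0 < (n + 1 - w) ^ w := Nat.pow_pos (by omega)
    exact_mod_cast this.trans_le hdesc
  -- As n ≥ 2w, every factor of the falling factorial is at least n/2; squaring gives 4^w.
  have hN : (n : ℝ) ^ w * (n : ℝ) ^ w ≤ 4 ^ w * (n.descFactorial w : ℝ) ^ 2 := by
    have h1 : n ^ w ≤ 2 ^ w * n.descFactorial w := by
      calc n ^ w ≤ (2 * (n + 1 - w)) ^ w := Nat.pow_le_pow_left (by omega) _
        _ = 2 ^ w * (n + 1 - w) ^ w := mul_pow _ _ _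
        _ ≤ _ := Nat.mul_le_mul_left _ hdesc
    have h2 : (n : ℝ) ^ w ≤ 2 ^ w * n.descFactorial w := by exact_mod_cast h1
    calc (n : ℝ) ^ w * (n : ℝ) ^ w
        ≤ (2 ^ w * n.descFactorial w) * (2 ^ w * n.descFactorial w) :=
          mul_le_mul h2 h2 (by positivity) (by positivity)
      _ = (2 * 2) ^ w * (n.descFactorial w : ℝ) ^ 2 := by rw [mul_pow]; ring
      _ = _ := by norm_num
  have hS : ∀ S : Finset ι, ∑ x with T x = S, (∏ e ∈ A x.1 ∩ A x.2, (p e.1.card : ℝ))⁻¹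
      ≤ (n : ℝ) ^ w * (n : ℝ) ^ w * (w + 1) ^ w *
        ((n : ℝ) ^ #(S.biUnion E) * ∏ f ∈ S, (p #(E f) : ℝ))⁻¹ := fun S => by
    have hU : #(S.biUnion E) ≤ w := Finset.card_le_univ _
    have hnU : (n : ℝ) ^ #(S.biUnion E) ≠ 0 := by
      rcases Nat.eq_zero_or_pos n with rfl | h
      · have : #(S.biUnion E) = 0 := by omega
        simp [this]
      · positivity
    have hcardS : #{x | T x = S} ≤ n ^ w * ((w + 1) ^ w * n ^ (w - #(S.biUnion E))) := by
      refine le_trans (Finset.card_le_card ?_) (card_embedding_pairs_le n (S.biUnion E))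
      intro x hx
      simp only [Finset.mem_filter, Finset.mem_univ, true_and] at hx ⊢
      intro u hu
      obtain ⟨f, hf, huf⟩ := Finset.mem_biUnion.1 hu
      rw [← hx] at hf
      obtain ⟨g, -, hg⟩ := Finset.mem_image.1 (Finset.mem_filter.1 hf).2
      have hmem : x.1 u ∈ (E f).map x.1 := Finset.mem_map_of_mem _ huf
      rw [← show (E g).map x.2 = (E f).map x.1 from congrArg Subtype.val hg] at hmem
      obtain ⟨v, -, hv⟩ := Finset.mem_map.1 hmem
      exact ⟨v, hv⟩
    calc ∑ x with T x = S, (∏ e ∈ A x.1 ∩ A x.2, (p e.1.card : ℝ))⁻¹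
        = ∑ x with T x = S, (∏ f ∈ S, (p #(E f) : ℝ))⁻¹ := by
          refine Finset.sum_congr rfl fun x hx => ?_
          rw [hT, (Finset.mem_filter.1 hx).2, Finset.prod_image (hedge _).injOn]
          simp [edge]
      _ = #{x | T x = S} * (∏ f ∈ S, (p #(E f) : ℝ))⁻¹ := by
          rw [Finset.sum_const, nsmul_eq_mul]
      _ ≤ ((n : ℝ) ^ w * ((w + 1) ^ w * (n : ℝ) ^ (w - #(S.biUnion E))))
            * (∏ f ∈ S, (p #(E f) : ℝ))⁻¹ := by
          refine mul_le_mul_of_nonneg_right (by exact_mod_cast hcardS) ?_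
          exact inv_nonneg.2 (Finset.prod_nonneg fun f _ => (hpos f).le)
      _ = _ := by
          rw [mul_inv, ← Nat.sub_add_cancel hU, pow_add (n : ℝ) (w - _), Nat.sub_add_cancel hU]
          field_simp
  have hsum : ∑ x : (W ↪ Fin n) × (W ↪ Fin n) with ¬ Disjoint (A x.1) (A x.2),
        (∏ e ∈ A x.1 ∩ A x.2, (p e.1.card : ℝ))⁻¹
      ≤ (n : ℝ) ^ w * (n : ℝ) ^ w * (w + 1) ^ w * ∑ S : Finset ι with S.Nonempty,
          ((n : ℝ) ^ #(S.biUnion E) * ∏ f ∈ S, (p #(E f) : ℝ))⁻¹ := by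
    rw [← Finset.sum_fiberwise_of_maps_to (t := {S : Finset ι | S.Nonempty}) (g := T),
      Finset.mul_sum]
    · refine Finset.sum_le_sum fun S _ => le_trans ?_ (hS S)
      refine Finset.sum_le_sum_of_subset_of_nonneg ?_ fun x _ _ =>
        inv_nonneg.2 (Finset.prod_nonneg fun _ _ => (p _).2.1)
      rw [Finset.filter_filter]
      exact fun x hx => Finset.mem_filter.2 ⟨Finset.mem_univ _, (Finset.mem_filter.1 hx).2.2⟩
    · intro x hx
      have h := (Finset.mem_filter.1 hx).2
      rw [Finset.not_disjoint_iff_nonempty_inter, hT, Finset.image_nonempty] at h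
      simpa using h
  have hsum0 : 0 ≤ ∑ S : Finset ι with S.Nonempty,
      ((n : ℝ) ^ #(S.biUnion E) * ∏ f ∈ S, (p #(E f) : ℝ))⁻¹ :=
    Finset.sum_nonneg fun S _ => inv_nonneg.2 (mul_nonneg (by positivity)
      (Finset.prod_nonneg fun f _ => (hpos f).le))
  refine le_of_mul_le_mul_right (hmom.trans (hsum.trans ?_)) (pow_pos hN0 2)
  calc _ ≤ 4 ^ w * (n.descFactorial w : ℝ) ^ 2 * (w + 1) ^ w * _ := by gcongr
    _ = _ := by ring

/-- Second moment bound for covering a copy of a fixed set system by edges of given sizes. -/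
theorem randomLaw_real_no_superedges_le {W ι : Type*} [Fintype W] [Fintype ι] [DecidableEq W]
    {n b : ℕ} (p : ℕ → unitInterval) (E : ι → Finset W) (hE : Injective E)
    (hne : ∀ f, (E f).Nonempty) (j : ι → ℕ) (hj : ∀ f, #(E f) ≤ j f)
    (hpos : ∀ f, 0 < (p (j f) : ℝ)) (hb : Fintype.card W + ∑ f, (j f - #(E f)) ≤ b)
    (hn : 2 * b ≤ n) :
    (randomLaw n p).real
        {ω | ¬ ∃ ψ : W ↪ Fin n, ∀ f, ∃ e, (E f).map ψ ⊆ e.1 ∧ ω e = true}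
      ≤ 4 ^ b * (b + 1) ^ b * ∑ S : Finset ι with S.Nonempty,
          ((n : ℝ) ^ #(S.biUnion E) * ∏ f ∈ S, ((n : ℝ) ^ (j f - #(E f)) * (p (j f) : ℝ)))⁻¹ := by
  classical
  -- Each set gets its own new vertices, bringing it to size exactly `j f`; privacy makes the vertex
  -- counts of unions additive.
  let E' : ι → Finset (W ⊕ Σ f, Fin (j f - #(E f))) := fun f =>
    (E f).disjSum (Finset.univ.map (Embedding.sigmaMk f))
  have hcard : ∀ f, #(E' f) = j f := fun f => by
    simp [E', Finset.card_disjSum, Nat.add_sub_cancel' (hj f)]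
  have hleft : ∀ f x, Sum.inl x ∈ E' f ↔ x ∈ E f := fun f x => Finset.inl_mem_disjSum
  have hE' : Injective E' := fun f g h => hE <| by
    ext x
    rw [← hleft, h, hleft]
  have hne' : ∀ f, (E' f).Nonempty := fun f => by
    obtain ⟨x, hx⟩ := hne f
    exact ⟨Sum.inl x, (hleft f x).2 hx⟩
  have hunion : ∀ S : Finset ι, #(S.biUnion E') = #(S.biUnion E) + ∑ f ∈ S, (j f - #(E f)) := by
    intro S
    have : S.biUnion E' = (S.biUnion E).disjSum (S.sigma fun f => Finset.univ) := by
      ext x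
      rcases x with x | ⟨f, x⟩
      · simp [E']
      · simp only [E', Finset.mem_biUnion, Finset.inr_mem_disjSum, Finset.mem_map,
          Finset.mem_univ, true_and, Embedding.sigmaMk_apply, Finset.mem_sigma, and_true]
        constructor
        · rintro ⟨g, hg, y, hy⟩
          cases hy
          exact hg
        · exact fun h => ⟨f, h, x, rfl⟩
    rw [this, Finset.card_disjSum, Finset.card_sigma]
    simp
  have hw : Fintype.card (W ⊕ Σ f, Fin (j f - #(E f))) ≤ b := by simpa using hb
  have key := randomLaw_real_no_copy_le p E' hE' hne' (fun f => by rw [hcard]; exact hpos f)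
    (le_trans (Nat.mul_le_mul_left 2 hw) hn)
  refine le_trans (measureReal_mono ?_ (measure_ne_top _ _)) (key.trans ?_)
  · rintro ω h ⟨ψ, hψ⟩
    refine h ⟨⟨fun x => ψ (Sum.inl x), ψ.injective.comp Sum.inl_injective⟩, fun f =>
      ⟨_, ?_, hψ f⟩⟩
    intro y hy
    obtain ⟨x, hx, rfl⟩ := Finset.mem_map.1 hy
    exact Finset.mem_map_of_mem ψ ((hleft f x).2 hx)
  · have hsum : ∀ S : Finset ι, ((n : ℝ) ^ #(S.biUnion E') * ∏ f ∈ S, (p #(E' f) : ℝ))⁻¹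
        = ((n : ℝ) ^ #(S.biUnion E) * ∏ f ∈ S, ((n : ℝ) ^ (j f - #(E f)) * (p (j f) : ℝ)))⁻¹ := by
      intro S
      rw [hunion, pow_add, Finset.prod_mul_distrib, Finset.prod_pow_eq_pow_sum, mul_assoc]
      simp only [hcard]
    simp only [hsum]
    refine mul_le_mul_of_nonneg_right ?_ (Finset.sum_nonneg fun S _ => inv_nonneg.2
      (mul_nonneg (by positivity) (Finset.prod_nonneg fun f _ =>
        mul_nonneg (by positivity) (hpos f).le)))
    have h1 : (4 : ℝ) ^ Fintype.card (W ⊕ Σ f, Fin (j f - #(E f))) ≤ 4 ^ b :=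
      pow_le_pow_right₀ (by norm_num) hw
    have h2 : ((Fintype.card (W ⊕ Σ f, Fin (j f - #(E f))) : ℝ) + 1)
        ^ Fintype.card (W ⊕ Σ f, Fin (j f - #(E f))) ≤ ((b : ℝ) + 1) ^ b := by
      refine (pow_le_pow_left₀ (by positivity) (?_ : _ ≤ (b : ℝ) + 1) _).trans
        (pow_le_pow_right₀ (by linarith [(Nat.cast_nonneg b : (0 : ℝ) ≤ b)]) hw)
      gcongr
    exact mul_le_mul h1 h2 (by positivity) (by positivity)

/-- Up to a constant factor, `p'_r` is its largest summand. -/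
theorem exists_pPrime_le {M n r : ℕ} {p : ℕ → unitInterval} (h : 0 < pPrime M p n r) :
    ∃ j ∈ Finset.Icc r M, 0 < (p j : ℝ) ∧
      pPrime M p n r ≤ (M + 1) * ((n : ℝ) ^ (j - r) * (p j : ℝ)) := by
  have hne : (Finset.Icc r M).Nonempty := by
    by_contra h0
    rw [Finset.not_nonempty_iff_eq_empty] at h0
    simp [pPrime, h0] at h
  obtain ⟨j, hj, hmax⟩ := Finset.exists_max_image _
    (fun j => (n : ℝ) ^ (j - r) * (p j : ℝ)) hne
  have h0 : 0 ≤ (n : ℝ) ^ (j - r) * (p j : ℝ) := mul_nonneg (by positivity) (p j).2.1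
  have hle : pPrime M p n r ≤ (M + 1) * ((n : ℝ) ^ (j - r) * (p j : ℝ)) := by
    refine (Finset.sum_le_card_nsmul _ _ _ hmax).trans ?_
    rw [nsmul_eq_mul, Nat.card_Icc]
    refine mul_le_mul_of_nonneg_right ?_ h0
    exact_mod_cast Nat.sub_le _ _
  refine ⟨j, hj, (p j).2.1.lt_of_ne fun hp => ?_, hle⟩
  rw [← hp] at hle
  simp at hle
  linarith

/-- Second moment bound for covering a copy of a fixed set system by edges. -/
theorem randomLaw_real_no_cover_le {W ι : Type*} [Fintype W] [Fintype ι] [DecidableEq W]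
    {n M : ℕ} {p : ℕ → unitInterval} (E : ι → Finset W) (hE : Injective E)
    (hne : ∀ f, (E f).Nonempty) (hpos : ∀ f, 0 < pPrime M p n #(E f)) {b : ℕ}
    (hb : Fintype.card W + Fintype.card ι * M ≤ b) (hn : 2 * b ≤ n) :
    (randomLaw n p).real
        {ω | ¬ ∃ ψ : W ↪ Fin n, ∀ f, ∃ e, (E f).map ψ ⊆ e.1 ∧ ω e = true}
      ≤ 4 ^ b * (b + 1) ^ b * ∑ S : Finset ι with S.Nonempty,
          (M + 1) ^ #S * ((n : ℝ) ^ #(S.biUnion E) * ∏ f ∈ S, pPrime M p n #(E f))⁻¹ := by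
  -- The dominant size may vary with n, but the bound `b` on the number of padded vertices does not.
  choose j hj hpj hle using fun f => exists_pPrime_le (hpos f)
  refine (randomLaw_real_no_superedges_le p E hE hne j (fun f => (Finset.mem_Icc.1 (hj f)).1)
    hpj (le_trans ?_ hb) hn).trans ?_
  · refine Nat.add_le_add_left ((Finset.sum_le_card_nsmul _ _ M fun f _ => ?_).trans ?_) _
    · exact (Nat.sub_le _ _).trans (Finset.mem_Icc.1 (hj f)).2
    · simp
  · refine mul_le_mul_of_nonneg_left (Finset.sum_le_sum fun S hS => ?_) (by positivity)
    obtain ⟨f, hf⟩ := (Finset.mem_filter.1 hS).2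
    have hn0 : 0 < n := by
      have : 0 < Fintype.card W := Fintype.card_pos_iff.2 ⟨(hne f).choose⟩
      omega
    have hterm : 0 < ∏ f ∈ S, pPrime M p n #(E f) := Finset.prod_pos fun f _ => hpos f
    have hprod : ∏ f ∈ S, pPrime M p n #(E f)
        ≤ (M + 1) ^ #S * ∏ f ∈ S, ((n : ℝ) ^ (j f - #(E f)) * (p (j f) : ℝ)) := by
      rw [← Finset.prod_const, ← Finset.prod_mul_distrib]
      exact Finset.prod_le_prod (fun f _ => (hpos f).le) fun f _ => hle f
    have hbig : 0 < ∏ f ∈ S, ((n : ℝ) ^ (j f - #(E f)) * (p (j f) : ℝ)) :=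
      Finset.prod_pos fun f _ => mul_pos (by positivity) (hpj f)
    rw [← div_eq_mul_inv, le_div_iff₀ (by positivity), inv_mul_le_iff₀ (by positivity)]
    calc _ ≤ (n : ℝ) ^ #(S.biUnion E) *
          ((M + 1) ^ #S * ∏ f ∈ S, ((n : ℝ) ^ (j f - #(E f)) * (p (j f) : ℝ))) := by gcongr
      _ = _ := by ring

/-! ### Finite hypergraphs and their weights μ_w -/

variable {α : Type*}

theorem finite_edgeSet {K : Hypergraph α} (hK : K.vertexSet.Finite) : K.edgeSet.Finite :=
  hK.finite_subsets.subset fun _ he => K.subset_vertexSet_of_mem_edgeSet' he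

/-- Groups the edges by size. Edges must be nonempty because the product in `muW` starts at r = 1.
-/
theorem muW_eq_prod (M : ℕ) (p : ℕ → unitInterval) (n : ℕ) {K : Hypergraph α} (U : Finset α)
    (F : Finset (Set α)) (hU : K.vertexSet = U) (hF : K.edgeSet = F)
    (hne : ∀ e ∈ K.edgeSet, e.Nonempty) :
    muW M p n K = (n : ℝ) ^ #U * ∏ e ∈ F, pPrime M p n e.ncard := by
  classical
  have hfin : K.vertexSet.Finite := hU ▸ U.finite_toSet
  have hnum : ∀ r, K.numEdges r = #{e ∈ F | e.ncard = r} := fun r => by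
    rw [numEdges, hF, ← Set.ncard_coe_finset]
    congr 1
    ext e
    simp
  have hmaps : ∀ e ∈ F, e.ncard ∈ Finset.Icc 1 K.vertexSet.ncard := fun e he => by
    have he' : e ∈ K.edgeSet := by rw [hF]; exact he
    have hsub := K.subset_vertexSet_of_mem_edgeSet' he'
    rw [Finset.mem_Icc]
    exact ⟨(Set.ncard_pos (hfin.subset hsub)).2 (hne e he'), Set.ncard_le_ncard hsub hfin⟩
  rw [muW, ← Finset.prod_fiberwise_of_maps_to' hmaps (fun r => pPrime M p n r)]
  congr 1
  · rw [hU, Set.ncard_coe_finset]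
  · refine Finset.prod_congr rfl fun r _ => ?_
    rw [Finset.prod_const, hnum]

/-- An edge, as a finite set of vertices. -/
noncomputable def edgeTrace (K : Hypergraph α) [Fintype K.vertexSet] (f : K.edgeSet) :
    Finset K.vertexSet :=
  open scoped Classical in {x | x.1 ∈ f.1}

theorem mem_edgeTrace {K : Hypergraph α} [Fintype K.vertexSet] {f : K.edgeSet}
    {x : K.vertexSet} : x ∈ K.edgeTrace f ↔ x.1 ∈ f.1 := by
  simp [edgeTrace]

theorem coe_image_edgeTrace (K : Hypergraph α) [Fintype K.vertexSet] (f : K.edgeSet) :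
    Subtype.val '' (K.edgeTrace f : Set K.vertexSet) = f.1 := by
  ext x
  simp only [Set.mem_image, Finset.mem_coe, mem_edgeTrace]
  constructor
  · rintro ⟨y, hy, rfl⟩
    exact hy
  · exact fun hx => ⟨⟨x, K.subset_vertexSet_of_mem_edgeSet' f.2 hx⟩, hx, rfl⟩

theorem card_edgeTrace (K : Hypergraph α) [Fintype K.vertexSet] (f : K.edgeSet) :
    #(K.edgeTrace f) = f.1.ncard := by
  rw [← Set.ncard_coe_finset, ← coe_image_edgeTrace, Set.ncard_image_of_injective _
    Subtype.val_injective]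

theorem edgeTrace_injective (K : Hypergraph α) [Fintype K.vertexSet] :
    Injective K.edgeTrace := fun f g h => by
  rw [Subtype.ext_iff, ← coe_image_edgeTrace, h, coe_image_edgeTrace]

/-! ### Coverings and subedge systems -/

/-- The hypergraph `K` can be placed on the vertices of the random hypergraph such that its edges
are contained in distinct random edges. -/
def IsCovered (K : Hypergraph α) {n : ℕ} (ω : Outcome n) : Prop :=
  ∃ (ψ : K.vertexSet ↪ Fin n) (g : K.edgeSet → {e : Finset (Fin n) // e.Nonempty}),
    Injective g ∧ ∀ f, (∀ x : K.vertexSet, x.1 ∈ f.1 → ψ x ∈ (g f).1) ∧ ω (g f) = true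

theorem IsStrongSub.isCovered {K K' : Hypergraph α} (h : K'.IsStrongSub K) {n : ℕ}
    {ω : Outcome n} (hK : K.IsCovered ω) : K'.IsCovered ω := by
  obtain ⟨ψ, g, hg, hf⟩ := hK
  exact ⟨(Set.embeddingOfSubset _ _ h.1).trans ψ, fun f => g ⟨f.1, h.2 f.2⟩,
    fun a b hab => Subtype.ext (congrArg Subtype.val (hg hab) :),
    fun f => ⟨fun x hx => (hf ⟨f.1, h.2 f.2⟩).1 ⟨x.1, h.1 x.2⟩ hx, (hf _).2⟩⟩

/-- A subedge system assigns distinct larger edges to its edges. -/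
theorem IsSubedgeSystem.exists_injOn {K H : Hypergraph α} (h : K.IsSubedgeSystem H) :
    K.vertexSet ⊆ H.vertexSet ∧ ∃ s : Set α → Set α, Set.InjOn s K.edgeSet ∧
      ∀ f ∈ K.edgeSet, s f ∈ H.edgeSet ∧ f ⊆ s f := by
  obtain ⟨φ, H', hφ, hV, hE, hK⟩ := h
  refine ⟨hV ▸ hK.1, ?_⟩
  have : ∀ f ∈ K.edgeSet, ∃ e ∈ H.edgeSet, φ e = f := fun f hf => by
    have := hK.2 hf
    rwa [hE] at this
  choose! s hs hφs using this
  refine ⟨s, fun a ha b hb hab => ?_, fun f hf => ⟨hs f hf, ?_⟩⟩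
  · rw [← hφs a ha, hab, hφs b hb]
  · conv_lhs => rw [← hφs f hf]
    exact hφ _ (hs f hf)

theorem IsSubedgeSystem.isCovered {K H : Hypergraph α} (h : K.IsSubedgeSystem H) {n : ℕ}
    {ω : Outcome n} (hH : H.IsCovered ω) : K.IsCovered ω := by
  obtain ⟨hV, s, hs, hsE⟩ := h.exists_injOn
  obtain ⟨ψ, g, hg, hf⟩ := hH
  refine ⟨(Set.embeddingOfSubset _ _ hV).trans ψ, fun f => g ⟨s f.1, (hsE f.1 f.2).1⟩,
    fun a b hab => Subtype.ext (hs a.2 b.2 (congrArg Subtype.val (hg hab) :)),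
    fun f => ⟨fun x hx => (hf ⟨s f.1, (hsE f.1 f.2).1⟩).1 ⟨x.1, hV x.2⟩ ((hsE f.1 f.2).2 hx),
      (hf _).2⟩⟩

/-- The sum of `|e| + 1` over the edges `e`. -/
noncomputable def weight (K : Hypergraph α) : ℕ := ∑ᶠ e ∈ K.edgeSet, (e.ncard + 1)

/-- Shrinking or deleting an edge strictly lowers the weight, so a subedge system that loses no
weight has changed no edge. -/
theorem IsSubedgeSystem.edgeSet_eq {K H : Hypergraph α} (h : K.IsSubedgeSystem H)
    (hfin : H.vertexSet.Finite) (hw : H.weight ≤ K.weight) : K.edgeSet = H.edgeSet := by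
  classical
  obtain ⟨hV, s, hs, hsE⟩ := h.exists_injOn
  have hH := finite_edgeSet hfin
  have hK := finite_edgeSet (hfin.subset hV)
  have hefin : ∀ e ∈ H.edgeSet, e.Finite := fun e he =>
    hfin.subset (H.subset_vertexSet_of_mem_edgeSet' he)
  rw [weight, weight, finsum_mem_eq_finite_toFinset_sum _ hH,
    finsum_mem_eq_finite_toFinset_sum _ hK] at hw
  have hle : ∀ f ∈ hK.toFinset, f.ncard + 1 ≤ (s f).ncard + 1 := fun f hf => by
    have hf' := hsE f (hK.mem_toFinset.1 hf)
    exact Nat.succ_le_succ (Set.ncard_le_ncard hf'.2 (hefin _ hf'.1))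
  have himg : hK.toFinset.image s ⊆ hH.toFinset := fun e he => by
    obtain ⟨f, hf, rfl⟩ := Finset.mem_image.1 he
    exact hH.mem_toFinset.2 (hsE f (hK.mem_toFinset.1 hf)).1
  have hsum : ∑ f ∈ hK.toFinset, ((s f).ncard + 1) ≤ ∑ e ∈ hH.toFinset, (e.ncard + 1) := by
    rw [← Finset.sum_image (f := fun e : Set α => e.ncard + 1) (g := s)
      fun a ha b hb hab => hs (hK.mem_toFinset.1 ha) (hK.mem_toFinset.1 hb) hab]
    exact Finset.sum_le_sum_of_subset himg
  have heq := (Finset.sum_eq_sum_iff_of_le hle).1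
    (le_antisymm (Finset.sum_le_sum hle) (hsum.trans hw))
  have hsf : ∀ f ∈ K.edgeSet, s f = f := fun f hf => by
    have h1 := heq f (hK.mem_toFinset.2 hf)
    exact (Set.eq_of_subset_of_ncard_le (hsE f hf).2 (by omega) (hefin _ (hsE f hf).1)).symm
  have hsub : hK.toFinset ⊆ hH.toFinset := fun f hf => by
    have hf' := hK.mem_toFinset.1 hf
    rw [hH.mem_toFinset, ← hsf f hf']
    exact (hsE f hf').1
  have : hK.toFinset = hH.toFinset := by
    refine hsub.antisymm fun e he => ?_
    by_contra hne
    -- The +1 in the weight makes even an empty missing edge count.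
    exact hw.not_gt (Finset.sum_lt_sum_of_subset hsub he hne (Nat.succ_pos _) fun _ _ _ =>
      Nat.zero_le _)
  rw [← hK.coe_toFinset, this, hH.coe_toFinset]

section Graph

variable {V : Type*} [Finite V] {G : SimpleGraph V}

/-- The traces of the random edges on a copy of `G`. -/
theorem exists_isCovered {n : ℕ} {ω : Outcome n} (h : G.IsContained (ofOutcome ω).twoSection) :
    ∃ K : Hypergraph ℕ, K.vertexSet = Set.Iio (Nat.card V) ∧ G.IsContained K.twoSection ∧
      K.IsCovered ω := by
  obtain ⟨φ⟩ := h
  let ε := Finite.equivFin V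
  let ψ : Set.Iio (Nat.card V) ↪ Fin n :=
    ⟨fun x => (φ (ε.symm ⟨x.1, x.2⟩)).1, fun x y hxy => by
      have := ε.symm.injective (φ.injective (Subtype.ext hxy))
      exact Subtype.ext (congrArg Fin.val this)⟩
  -- Distinct traces come from distinct random edges, so choosing a preimage of each trace is
  -- injective.
  let tr : {e : Finset (Fin n) // e.Nonempty} → Set ℕ := fun e => Subtype.val '' {x | ψ x ∈ e.1}
  let K : Hypergraph ℕ :=
    { vertexSet := Set.Iio (Nat.card V)
      edgeSet := tr '' {e | ω e = true}
      subset_vertexSet_of_mem_edgeSet' := by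
        rintro _ ⟨e, -, rfl⟩ _ ⟨x, -, rfl⟩
        exact x.2 }
  have hψ : ∀ v, ψ ⟨ε v, (ε v).2⟩ = (φ v).1 := fun v => by
    show (φ (ε.symm (ε v))).1 = _
    rw [ε.symm_apply_apply]
  refine ⟨K, rfl, ⟨⟨⟨fun v => ⟨ε v, (ε v).2⟩, ?_⟩, ?_⟩⟩, ψ, ?_⟩
  · intro v w hvw
    obtain ⟨hne, s, ⟨e, he, rfl⟩, hv, hw⟩ := φ.toHom.map_adj hvw
    refine ⟨fun h => hvw.ne (ε.injective (Fin.ext (congrArg Subtype.val h))), tr e,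
      ⟨e, he, rfl⟩, ⟨⟨ε v, (ε v).2⟩, ?_, rfl⟩, ⟨⟨ε w, (ε w).2⟩, ?_, rfl⟩⟩
    · show ψ _ ∈ e.1
      rw [hψ]
      exact hv
    · show ψ _ ∈ e.1
      rw [hψ]
      exact hw
  · intro v w hvw
    exact ε.injective (Fin.ext (congrArg Subtype.val hvw))
  · choose g hg htr using fun f : K.edgeSet => f.2
    refine ⟨g, fun a b hab => Subtype.ext ?_, fun f => ⟨fun x hx => ?_, hg f⟩⟩
    · rw [← htr a, hab, htr b]
    · rw [← htr f] at hx
      obtain ⟨y, hy, hyx⟩ := hx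
      rw [← Subtype.ext hyx]
      exact hy

/-- Among covered hypergraphs on this vertex set containing G, one of least weight is minimal: a
subedge system still containing G is covered, keeps all vertices since G needs |V| of them, and
cannot weigh less. -/
theorem exists_mem_minimalFamily_isCovered {n : ℕ} {ω : Outcome n}
    (h : G.IsContained (ofOutcome ω).twoSection) :
    ∃ K ∈ minimalFamily G, K.vertexSet = Set.Iio (Nat.card V) ∧ K.IsCovered ω := by
  obtain ⟨K, ⟨hV, hG, hK⟩, hmin⟩ := exists_minimalFor_of_wellFoundedLT
    (fun K : Hypergraph ℕ => K.vertexSet = Set.Iio (Nat.card V) ∧ G.IsContained K.twoSection ∧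
      K.IsCovered ω) weight (exists_isCovered h)
  have hfin : K.vertexSet.Finite := hV ▸ Set.finite_Iio _
  refine ⟨K, ⟨hfin, hG, fun K' hK' hG' => ?_⟩, hV, hK⟩
  have hV' : K'.vertexSet = K.vertexSet := by
    refine Set.eq_of_subset_of_ncard_le hK'.exists_injOn.1 ?_ hfin
    obtain ⟨φ⟩ := hG'
    have : Finite K'.vertexSet := (hfin.subset hK'.exists_injOn.1).to_subtype
    have hc := Nat.card_le_card_of_injective φ φ.injective
    rw [hV, Set.ncard_eq_toFinset_card']
    simpa using hc
  refine Hypergraph.ext hV' (hK'.edgeSet_eq hfin ?_)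
  have hQ : K'.vertexSet = Set.Iio (Nat.card V) ∧ G.IsContained K'.twoSection ∧
      K'.IsCovered ω := ⟨hV'.trans hV, hG', hK'.isCovered hK⟩
  rcases le_total (weight K) (weight K') with h | h
  · exact h
  · exact hmin hQ h

end Graph

/-- Empty edges create no adjacency, so minimality excludes them. -/
theorem nonempty_of_mem_minimalFamily {V : Type*} {G : SimpleGraph V} {H : Hypergraph ℕ} (hH : H ∈ minimalFamily G) {e : Set ℕ}
    (he : e ∈ H.edgeSet) : e.Nonempty := by
  obtain ⟨-, hG, hmin⟩ := hH
  by_contra h0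
  let K : Hypergraph ℕ :=
    { vertexSet := H.vertexSet
      edgeSet := {f ∈ H.edgeSet | f.Nonempty}
      subset_vertexSet_of_mem_edgeSet' := fun f hf => H.subset_vertexSet_of_mem_edgeSet' hf.1 }
  have hK : K = H := by
    refine hmin K ⟨id, H, fun _ _ => subset_rfl, rfl, by simp, subset_rfl, fun f hf => hf.1⟩ ?_
    refine hG.trans (SimpleGraph.IsContained.of_le (G₂ := K.twoSection) ?_)
    rintro u v ⟨huv, f, hf, hu, hv⟩
    exact ⟨huv, f, ⟨hf, ⟨_, hu⟩⟩, hu, hv⟩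
  rw [← hK] at he
  exact h0 he.2


/-! ### Asymptotics -/

theorem tendsto_randomLaw_compl {p : ℕ → ℕ → unitInterval} {B : ∀ n, Set (Outcome n)}
    (h : Tendsto (fun n => (randomLaw n (p n)).real (B n)) atTop (𝓝 0)) :
    Tendsto (fun n => randomLaw n (p n) (B n)ᶜ) atTop (𝓝 1) := by
  have h1 : Tendsto (fun n => (randomLaw n (p n)).real (B n)ᶜ) atTop (𝓝 1) := by
    have : ∀ n, (randomLaw n (p n)).real (B n)ᶜ = 1 - (randomLaw n (p n)).real (B n) := fun n =>
      probReal_compl_eq_one_sub (Set.toFinite _).measurableSet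
    simp only [this]
    simpa using h.const_sub 1
  rw [← ENNReal.tendsto_toReal_iff (fun n => measure_ne_top _ _) ENNReal.one_ne_top]
  rwa [ENNReal.toReal_one]

theorem randomLaw_real_isCovered_le {K : Hypergraph α} (hfin : K.vertexSet.Finite)
    (hne : ∀ e ∈ K.edgeSet, e.Nonempty) {n M : ℕ} {p : ℕ → unitInterval}
    (hp : ∀ r, M < r → p r = 0) :
    (randomLaw n p).real {ω | K.IsCovered ω} ≤ muW M p n K := by
  classical
  have := hfin.fintype
  have := (finite_edgeSet hfin).fintype
  rw [muW_eq_prod M p n K.vertexSet.toFinset K.edgeSet.toFinset (by simp) (by simp) hne]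
  refine (measureReal_mono ?_ (measure_ne_top _ _)).trans
    ((randomLaw_real_superedges_le hp K.edgeTrace).trans (le_of_eq ?_))
  · rintro ω ⟨ψ, g, hg, h⟩
    refine ⟨ψ, g, hg, fun f => ⟨fun y hy => ?_, (h f).2⟩⟩
    obtain ⟨x, hx, rfl⟩ := Finset.mem_map.1 hy
    exact (h f).1 x (mem_edgeTrace.1 hx)
  · simp only [card_edgeTrace, Set.toFinset_card]
    congr 1
    exact (Finset.prod_subtype (p := (· ∈ K.edgeSet)) K.edgeSet.toFinset (by simp)
      (fun e : Set α => pPrime M p n e.ncard)).symm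

/-- The strong subhypergraph with the edges in `S` and no isolated vertices. -/
def edgeSub (H : Hypergraph α) (S : Finset H.edgeSet) : Hypergraph α where
  vertexSet := ⋃ f ∈ S, f.1
  edgeSet := Subtype.val '' (S : Set H.edgeSet)
  subset_vertexSet_of_mem_edgeSet' := by
    rintro _ ⟨f, hf, rfl⟩
    exact Set.subset_biUnion_of_mem (u := fun f : H.edgeSet => f.1) hf

theorem edgeSub_isStrongSub (H : Hypergraph α) (S : Finset H.edgeSet) :
    (H.edgeSub S).IsStrongSub H := by
  refine ⟨Set.iUnion₂_subset fun f _ => H.subset_vertexSet_of_mem_edgeSet' f.2, ?_⟩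
  rintro _ ⟨f, -, rfl⟩
  exact f.2

theorem muW_edgeSub (M : ℕ) (p : ℕ → unitInterval) (n : ℕ) {H : Hypergraph α}
    [Fintype H.vertexSet] [DecidableEq H.vertexSet] (hne : ∀ e ∈ H.edgeSet, e.Nonempty)
    (S : Finset H.edgeSet) :
    muW M p n (H.edgeSub S)
      = (n : ℝ) ^ #(S.biUnion H.edgeTrace) * ∏ f ∈ S, pPrime M p n #(H.edgeTrace f) := by
  rw [muW_eq_prod M p n ((S.biUnion H.edgeTrace).map (Embedding.subtype _))
    (S.map (Embedding.subtype _)), Finset.card_map, Finset.prod_map]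
  · simp only [card_edgeTrace, Embedding.coe_subtype]
  · rw [Finset.coe_map, Finset.coe_biUnion, Embedding.coe_subtype, Set.image_iUnion₂]
    simp only [coe_image_edgeTrace]
    rfl
  · rw [Finset.coe_map]
    rfl
  · rintro _ ⟨f, -, rfl⟩
    exact hne _ f.2

/-- If all strong subhypergraphs of `H` are expected to be numerous, then asymptotically almost
surely `H` can be placed such that its edges are contained in random edges. -/
theorem tendsto_randomLaw_no_cover {M : ℕ} {p : ℕ → ℕ → unitInterval} {H : Hypergraph α}
    [Fintype H.vertexSet] (hne : ∀ e ∈ H.edgeSet, e.Nonempty)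
    (hmu : ∀ H' : Hypergraph α, H'.IsStrongSub H → H'.vertexSet.Nonempty →
      Tendsto (fun n => H'.muW M (p n) n) atTop atTop) :
    Tendsto (fun n => (randomLaw n (p n)).real {ω | ¬ ∃ ψ : H.vertexSet ↪ Fin n, ∀ f, ∃ e,
      (H.edgeTrace f).map ψ ⊆ e.1 ∧ ω e = true}) atTop (𝓝 0) := by
  classical
  have := (finite_edgeSet H.vertexSet.toFinite).fintype
  have hmuS : ∀ S : Finset H.edgeSet, S.Nonempty →
      Tendsto (fun n => (H.edgeSub S).muW M (p n) n) atTop atTop := fun S ⟨f, hf⟩ => by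
    refine hmu _ (H.edgeSub_isStrongSub S) ?_
    obtain ⟨x, hx⟩ := hne f.1 f.2
    exact ⟨x, Set.mem_biUnion hf hx⟩
  have hneT : ∀ f, (H.edgeTrace f).Nonempty := fun f => by
    obtain ⟨x, hx⟩ := hne f.1 f.2
    exact ⟨⟨x, H.subset_vertexSet_of_mem_edgeSet' f.2 hx⟩, mem_edgeTrace.2 hx⟩
  -- The subgraph consisting of a single edge has μ_w tending to infinity, so its factor `pPrime` is
  -- eventually nonzero.
  have hpos : ∀ᶠ n in atTop, ∀ f, 0 < pPrime M (p n) n #(H.edgeTrace f) := by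
    rw [eventually_all]
    intro f
    filter_upwards [(hmuS {f} (Finset.singleton_nonempty f)).eventually_gt_atTop 0] with n hn
    rw [muW_edgeSub _ _ _ hne, Finset.prod_singleton] at hn
    exact (pPrime_nonneg _ _ _ _).lt_of_ne fun h0 => by simp [← h0] at hn
  set b := Fintype.card H.vertexSet + Fintype.card H.edgeSet * M
  have hlim : Tendsto (fun n => (4 : ℝ) ^ b * (b + 1) ^ b *
      ∑ S : Finset H.edgeSet with S.Nonempty, (M + 1) ^ #S * ((H.edgeSub S).muW M (p n) n)⁻¹)
      atTop (𝓝 0) := by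
    rw [← mul_zero ((4 : ℝ) ^ b * (b + 1) ^ b)]
    refine Tendsto.const_mul _ ?_
    rw [← Finset.sum_const_zero (s := ({S : Finset H.edgeSet | S.Nonempty}))]
    refine tendsto_finsetSum _ fun S hS => ?_
    rw [← mul_zero (((M : ℝ) + 1) ^ #S)]
    exact (hmuS S (Finset.mem_filter.1 hS).2).inv_tendsto_atTop.const_mul _
  refine squeeze_zero' (Eventually.of_forall fun n => measureReal_nonneg) ?_ hlim
  filter_upwards [hpos, eventually_ge_atTop (2 * b)] with n hn hnb
  simp only [muW_edgeSub _ _ _ hne]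
  exact randomLaw_real_no_cover_le H.edgeTrace H.edgeTrace_injective hneT hn le_rfl hnb

end Hypergraph

theorem mainTheorem5 {V : Type*} [Finite V] (G : SimpleGraph V) (hG : ∀ v, ∃ w, G.Adj v w)
    (M : ℕ) (p : ℕ → ℕ → unitInterval) (hp : ∀ n r, M < r → p n r = 0) :
    ((∀ H ∈ Hypergraph.minimalFamily G, ∃ H' : Hypergraph ℕ,
        H'.IsStrongSub H ∧ H'.vertexSet.Nonempty ∧
          Tendsto (fun n => H'.muW M (p n) n) atTop (𝓝 0)) →
      Tendsto (fun n => Hypergraph.randomLaw n (p n)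
        {ω | ¬ G.IsContained (Hypergraph.ofOutcome ω).twoSection}) atTop (𝓝 1)) ∧
    ((∃ H ∈ Hypergraph.minimalFamily G, ∀ H' : Hypergraph ℕ,
        H'.IsStrongSub H → H'.vertexSet.Nonempty →
          Tendsto (fun n => H'.muW M (p n) n) atTop atTop) →
      Tendsto (fun n => Hypergraph.randomLaw n (p n)
        {ω | G.IsContained (Hypergraph.ofOutcome ω).twoSection}) atTop (𝓝 1)) := by
  classical
  constructor
  · intro h
    choose! K hK _ hlim using h
    -- Fixing the vertex set leaves finitely many members, as the union bound requires.
    let T : Set (Hypergraph ℕ) :=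
      {H | H ∈ Hypergraph.minimalFamily G ∧ H.vertexSet = Set.Iio (Nat.card V)}
    have hT : T.Finite := by
      refine Set.Finite.of_injOn (f := Hypergraph.edgeSet)
        (t := {F | F ⊆ {e | e ⊆ Set.Iio (Nat.card V)}}) ?_ ?_
        (Set.finite_Iio _).finite_subsets.finite_subsets
      · rintro H ⟨-, hV⟩ e he
        exact (H.subset_vertexSet_of_mem_edgeSet' he).trans hV.subset
      · rintro H ⟨-, hV⟩ H' ⟨-, hV'⟩ hE
        exact Hypergraph.ext (hV.trans hV'.symm) hE
    refine Hypergraph.tendsto_randomLaw_compl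
      (B := fun n => {ω | G.IsContained (Hypergraph.ofOutcome ω).twoSection}) ?_
    have hsum : Tendsto (fun n => ∑ H ∈ hT.toFinset, (K H).muW M (p n) n) atTop (𝓝 0) := by
      rw [← Finset.sum_const_zero (s := hT.toFinset)]
      exact tendsto_finsetSum _ fun H hH => hlim H (hT.mem_toFinset.1 hH).1
    refine squeeze_zero (fun n => measureReal_nonneg) (fun n => ?_) hsum
    refine (measureReal_mono (s₂ := ⋃ H ∈ hT.toFinset, {ω | (K H).IsCovered ω}) ?_
      (measure_ne_top _ _)).trans ((measureReal_biUnion_finset_le _ _).trans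
        (Finset.sum_le_sum fun H hH => ?_))
    · intro ω hω
      obtain ⟨H, hH, hV, hcov⟩ := Hypergraph.exists_mem_minimalFamily_isCovered hω
      exact Set.mem_biUnion (x := H) (hT.mem_toFinset.2 ⟨hH, hV⟩) ((hK H hH).isCovered hcov)
    · have hH' := (hT.mem_toFinset.1 hH).1
      exact Hypergraph.randomLaw_real_isCovered_le (hH'.1.subset (hK H hH').1)
        (fun e he => Hypergraph.nonempty_of_mem_minimalFamily hH' ((hK H hH').2 he)) (hp n)
  · rintro ⟨H, hH, hmu⟩
    have := hH.1.fintype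
    have hlim := Hypergraph.tendsto_randomLaw_compl (Hypergraph.tendsto_randomLaw_no_cover
      (fun e he => Hypergraph.nonempty_of_mem_minimalFamily hH he) hmu)
    refine tendsto_of_tendsto_of_tendsto_of_le_of_le hlim tendsto_const_nhds
      (fun n => measure_mono fun ω hω => ?_) fun n => prob_le_one
    obtain ⟨ψ, hψ⟩ := not_not.1 hω
    -- The placement embeds the 2-section of H in the random one; the covering edges may coincide.
    refine hH.2.1.trans ⟨⟨⟨fun x => ⟨ψ x, trivial⟩, ?_⟩, ?_⟩⟩
    · rintro u v ⟨huv, f, hf, hu, hv⟩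
      obtain ⟨e, he, heω⟩ := hψ ⟨f, hf⟩
      refine ⟨fun h => huv (ψ.injective (congrArg Subtype.val h)), e.1, ⟨e, heω, rfl⟩, ?_, ?_⟩
      · exact he (Finset.mem_map_of_mem ψ (Hypergraph.mem_edgeTrace.2 hu))
      · exact he (Finset.mem_map_of_mem ψ (Hypergraph.mem_edgeTrace.2 hv))
    · exact fun u v h => ψ.injective (congrArg Subtype.val h)
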